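/- Let $H$ be a real Hilbert space with scalar product $\langle\cdot,\cdot\rangle$ and norm $|\cdot|$, and let $B$ be a (possibly unbounded) self-adjoint linear operator on $H$ with dense domain $D(B)$ which is coercive with constant $b>0$: $\langle Bv,v\rangle\ge b|v|^2$ for all $v\in D(B)$. Let $V=D(B^{1/2})$ with norm $\|v\|=|B^{1/2}v|$, where $B^{1/2}$ is the nonnegative self-adjoint square root of $B$; let $V'$ be the dual of $V$, with $H\subset V'$ through the scalar product of $H$, and extend $B$ to an operator $V\to V'$ by $\langle Bu,v\rangle=\langle B^{1/2}u,B^{1/2}v\rangle$. Let $A\in L^\infty(\mathbb R^+,L(H))$, $\|A\|=\operatorname{ess\,sup}_{t\ge0}\|A(t)\|_{L(H)}$, and let $c>0$. Assume $$\|A\|<c\sqrt{b+\frac{c^2}{4}}-\frac{c^2}{2}.$$ Then there are $\delta>0$ and $M>0$ such that every solution $u\in C(\mathbb R^+,V)\cap C^1(\mathbb R^+,H)\cap W^{2,\infty}_{loc}(\mathbb R^+,V')$ of $$u''(t)+[B+A(t)]u(t)+c\,u'(t)=0\quad\text{in }V'\text{ for a.e. }t\ge0$$ (with arbitrary initial data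 $u(0)\in V$, $u'(0)\in H$) satisfies $$\|u(t)\|^2+|u'(t)|^2\le M\left[\|u(s)\|^2+|u'(s)|^2\right]e^{-\delta(t-s)}\qquad\text{whenever }0\le s\le t.$$ -/

import Mathlib

namespace DissipativeEvolution

/-! ### The square root of a self-adjoint coercive operator -/

section SquareRoot

variable {H : Type*} [NormedAddCommGroup H] [InnerProductSpace ℝ H]

/-- `⟨B x, x⟩ ≥ b |x|²` on the domain of the (unbounded) operator `B`. -/
def CoerciveWith (B : H →ₗ.[ℝ] H) (b : ℝ) : Prop :=
  ∀ x : B.domain, b * ‖(x : H)‖ ^ 2 ≤ inner ℝ (B x) (x : H)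

variable [CompleteSpace H]

/-- `S` is a nonnegative self-adjoint operator with `S ∘ S = B`, where the domain of `S ∘ S` is
`{x ∈ D(S) | S x ∈ D(S)}`. -/
structure IsNonnegSqrt (B S : H →ₗ.[ℝ] H) : Prop where
  isSelfAdjoint : IsSelfAdjoint S
  nonneg : ∀ x : S.domain, 0 ≤ inner ℝ (S x) (x : H)
  sq_eq : ∀ x y : H, (x, y) ∈ B.graph ↔ ∃ z, (x, z) ∈ S.graph ∧ (z, y) ∈ S.graph

/-- The coefficients of the power series of `(1 - √(1 - x)) / (x / 2)`. -/
noncomputable def sqrtCoeff (n : ℕ) : ℝ := (catalan n : ℝ) / 4 ^ n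

theorem sqrtCoeff_nonneg (n : ℕ) : 0 ≤ sqrtCoeff n := by
  unfold sqrtCoeff; positivity

theorem sum_sqrtCoeff (N : ℕ) :
    ∑ n ∈ Finset.range N, sqrtCoeff n = 2 * (1 - (Nat.centralBinom N : ℝ) / 4 ^ N) := by
  induction N with
  | zero => simp
  | succ N ih =>
    rw [Finset.sum_range_succ, ih, sqrtCoeff]
    have h1 : ((N : ℝ) + 1) * (catalan N : ℝ) = Nat.centralBinom N := by
      exact_mod_cast succ_mul_catalan_eq_centralBinom N
    have h2 : ((N : ℝ) + 1) * (Nat.centralBinom (N + 1) : ℝ)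
        = 2 * (2 * N + 1) * Nat.centralBinom N := by
      exact_mod_cast Nat.succ_mul_centralBinom_succ N
    have h3 : (Nat.centralBinom (N + 1) : ℝ) = 2 * (2 * N + 1) * catalan N := by
      have : (N : ℝ) + 1 ≠ 0 := by positivity
      apply mul_left_cancel₀ this
      rw [h2, ← h1]; ring
    rw [h3, ← h1, pow_succ]
    field_simp
    ring

theorem summable_sqrtCoeff : Summable sqrtCoeff := by
  refine summable_of_sum_range_le (c := 2) sqrtCoeff_nonneg fun N => ?_
  rw [sum_sqrtCoeff]
  have : (0 : ℝ) ≤ (Nat.centralBinom N : ℝ) / 4 ^ N := by positivity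
  linarith

theorem tsum_sqrtCoeff_le : ∑' n, sqrtCoeff n ≤ 2 := by
  refine Real.tsum_le_of_sum_range_le sqrtCoeff_nonneg fun N => ?_
  rw [sum_sqrtCoeff]
  have : (0 : ℝ) ≤ (Nat.centralBinom N : ℝ) / 4 ^ N := by positivity
  linarith

theorem sqrtCoeff_succ (n : ℕ) : sqrtCoeff (n + 1) =
    4⁻¹ * ∑ p ∈ Finset.HasAntidiagonal.antidiagonal n, sqrtCoeff p.1 * sqrtCoeff p.2 := by
  have : ∀ p ∈ Finset.HasAntidiagonal.antidiagonal n, sqrtCoeff p.1 * sqrtCoeff p.2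
      = (catalan p.1 * catalan p.2 : ℝ) / 4 ^ n := by
    intro p hp
    rw [Finset.HasAntidiagonal.mem_antidiagonal] at hp
    rw [sqrtCoeff, sqrtCoeff, ← hp, pow_add]
    field_simp
  rw [Finset.sum_congr rfl this, sqrtCoeff, catalan_succ', ← Finset.sum_div, pow_succ]
  push_cast
  field_simp

/-- A bounded self-adjoint operator `1 - X` with `‖X‖ ≤ 1` has a nonnegative self-adjoint square
root, which commutes with everything that commutes with `X`. -/
theorem exists_sqrt_one_sub (X : H →L[ℝ] H) (hX : ‖X‖ ≤ 1) (hs : IsSelfAdjoint X) :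
    ∃ R : H →L[ℝ] H, IsSelfAdjoint R ∧ (∀ x, 0 ≤ inner ℝ (R x) x) ∧ R * R = 1 - X ∧
      ∀ Q : H →L[ℝ] H, Commute Q X → Commute Q R := by
  have hXn : ∀ n, ‖X ^ n‖ ≤ 1 := by
    intro n
    induction n with
    | zero => rw [pow_zero]; exact ContinuousLinearMap.norm_id_le
    | succ n ih =>
      rw [pow_succ]
      exact (norm_mul_le _ _).trans (mul_le_one₀ ih (norm_nonneg _) hX)
  have hbd : ∀ n, ‖sqrtCoeff n • X ^ n‖ ≤ sqrtCoeff n := by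
    intro n
    rw [norm_smul, Real.norm_of_nonneg (sqrtCoeff_nonneg n)]
    exact mul_le_of_le_one_right (sqrtCoeff_nonneg n) (hXn n)
  have hsumn : Summable fun n => ‖sqrtCoeff n • X ^ n‖ :=
    Summable.of_nonneg_of_le (fun _ => norm_nonneg _) hbd summable_sqrtCoeff
  have hsum : Summable fun n => sqrtCoeff n • X ^ n := hsumn.of_norm
  set G : H →L[ℝ] H := ∑' n, sqrtCoeff n • X ^ n with hG
  have hGn : ‖G‖ ≤ 2 :=
    (tsum_of_norm_bounded summable_sqrtCoeff.hasSum hbd).trans tsum_sqrtCoeff_le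
  have hGs : IsSelfAdjoint G := by
    rw [IsSelfAdjoint, hG, tsum_star]
    congr 1
    ext1 n
    exact (((IsSelfAdjoint.all (sqrtCoeff n)).smul (hs.pow n)))
  have hcomm : ∀ Q : H →L[ℝ] H, Commute Q X → Commute Q G := fun Q hQ =>
    Commute.tsum_right _ fun n => (hQ.pow_right n).smul_right _
  have hXG : Commute X G := hcomm X (Commute.refl X)
  have hquad : G = 1 + (4⁻¹ : ℝ) • (X * (G * G)) := by
    have h2 : G * G = ∑' n, ∑ p ∈ Finset.HasAntidiagonal.antidiagonal n,
        (sqrtCoeff p.1 • X ^ p.1) * (sqrtCoeff p.2 • X ^ p.2) :=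
      tsum_mul_tsum_eq_tsum_sum_antidiagonal_of_summable_norm hsumn hsumn
    have h2s : Summable fun n => ∑ p ∈ Finset.HasAntidiagonal.antidiagonal n,
        (sqrtCoeff p.1 • X ^ p.1) * (sqrtCoeff p.2 • X ^ p.2) :=
      (summable_norm_sum_mul_antidiagonal_of_summable_norm hsumn hsumn).of_norm
    rw [h2, ← h2s.tsum_mul_left, ← (h2s.mul_left X).tsum_const_smul]
    conv_lhs => rw [hG, hsum.tsum_eq_zero_add]
    congr 1
    · simp [sqrtCoeff]
    · congr 1
      ext1 n
      have : ∀ p ∈ Finset.HasAntidiagonal.antidiagonal n, (sqrtCoeff p.1 • X ^ p.1) * (sqrtCoeff p.2 • X ^ p.2)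
          = (sqrtCoeff p.1 * sqrtCoeff p.2) • X ^ n := by
        intro p hp
        rw [Finset.HasAntidiagonal.mem_antidiagonal] at hp
        rw [smul_mul_smul_comm, ← pow_add, hp]
      rw [Finset.sum_congr rfl this, ← Finset.sum_smul, mul_smul_comm, smul_smul, ← pow_succ',
        sqrtCoeff_succ]
  refine ⟨1 - (2⁻¹ : ℝ) • (X * G), ?_, ?_, ?_, ?_⟩
  · refine (IsSelfAdjoint.one _).sub ((IsSelfAdjoint.all _).smul ?_)
    exact (hs.commute_iff hGs).1 hXG
  · intro x
    have h1 : ‖(X * G) x‖ ≤ 2 * ‖x‖ := by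
      refine (ContinuousLinearMap.le_opNorm _ _).trans ?_
      gcongr
      refine (norm_mul_le _ _).trans ?_
      nlinarith [norm_nonneg X, norm_nonneg G]
    have h2 : inner ℝ ((X * G) x) x ≤ 2 * ‖x‖ * ‖x‖ :=
      (real_inner_le_norm _ _).trans (by gcongr)
    have h3 : inner ℝ ((1 - (2⁻¹ : ℝ) • (X * G)) x) x
        = ‖x‖ * ‖x‖ - 2⁻¹ * inner ℝ ((X * G) x) x := by
      rw [sub_apply, inner_sub_left, smul_apply,
        real_inner_smul_left, one_apply_eq_self, real_inner_self_eq_norm_mul_norm]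
    rw [h3]; linarith
  · have h4 : (X * G) * (X * G) = X * (X * (G * G)) := by
      rw [mul_assoc, ← mul_assoc G X G, ← hXG.eq, mul_assoc X G G]
    have h5 : X * G = X + (4⁻¹ : ℝ) • (X * (X * (G * G))) := by
      conv_lhs => rw [hquad]
      rw [mul_add, mul_one, mul_smul_comm]
    have h6 : (1 - (2⁻¹ : ℝ) • (X * G)) * (1 - (2⁻¹ : ℝ) • (X * G))
        = 1 - X * G + (4⁻¹ : ℝ) • ((X * G) * (X * G)) := by
      rw [sub_mul, mul_sub, one_mul, mul_sub, mul_one, one_mul, smul_mul_smul_comm]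
      norm_num
      module
    rw [h6, h4]
    conv_lhs => rw [h5]
    abel
  · intro Q hQ
    exact (Commute.one_right Q).sub_right ((hQ.mul_right (hcomm Q hQ)).smul_right _)

/-- A self-adjoint coercive operator has a bounded everywhere defined inverse. -/
theorem exists_inverse {B : H →ₗ.[ℝ] H} {b : ℝ} (hB : IsSelfAdjoint B) (hb : 0 < b)
    (hcoer : CoerciveWith B b) :
    ∃ T : H →L[ℝ] H, ∀ x y, (x, y) ∈ B.graph ↔ x = T y := by
  have hlow : ∀ x : B.domain, b * ‖(x : H)‖ ≤ ‖B x‖ := by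
    intro x
    have h1 := hcoer x
    have h2 := real_inner_le_norm (B x) (x : H)
    rcases eq_or_lt_of_le (norm_nonneg (x : H)) with h | h
    · rw [← h]; simp
    · by_contra hcon
      push Not at hcon
      nlinarith
  have hdense := hB.dense_domain
  have hadj : B.adjoint = B := hB
  have hinj : ∀ x : B.domain, B x = 0 → x = 0 := by
    intro x hx
    have := hlow x
    rw [hx, norm_zero] at this
    have h0 : ‖(x : H)‖ ≤ 0 := by nlinarith [norm_nonneg (x : H)]
    exact Subtype.ext (norm_le_zero_iff.1 h0)
  set P : Submodule ℝ H := LinearMap.range B.toFun with hP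
  have hclosed : IsClosed (P : Set H) := by
    refine isClosed_of_closure_subset fun y hy => ?_
    obtain ⟨ys, hys, hlim⟩ := mem_closure_iff_seq_limit.1 hy
    choose xs hxs using hys
    have hxs' : ∀ n, B (xs n) = ys n := hxs
    have hc : CauchySeq fun n => ((xs n : B.domain) : H) := by
      have hcy := hlim.cauchySeq
      rw [Metric.cauchySeq_iff] at hcy ⊢
      intro ε hε
      obtain ⟨N, hN⟩ := hcy (b * ε) (by positivity)
      refine ⟨N, fun m hm n hn => ?_⟩
      have h1 := hN m hm n hn
      have h2 := hlow (xs m - xs n)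
      rw [LinearPMap.map_sub, hxs', hxs'] at h2
      rw [dist_eq_norm] at h1 ⊢
      exact lt_of_mul_lt_mul_left (h2.trans_lt h1) hb.le
    obtain ⟨x, hx⟩ := cauchySeq_tendsto_of_complete hc
    have hg : (x, y) ∈ B.graph := by
      have := hB.isClosed
      refine this.mem_of_tendsto (hx.prodMk_nhds hlim) (Filter.Eventually.of_forall fun n => ?_)
      rw [← hxs' n]
      exact B.mem_graph (xs n)
    obtain ⟨x', -, hx'⟩ := (LinearPMap.mem_graph_iff _).1 hg
    exact ⟨x', hx'⟩
  have horth : Pᗮ = ⊥ := by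
    rw [Submodule.eq_bot_iff]
    intro y hy
    have hy' : ∀ x : B.domain, inner ℝ (0 : H) (x : H) = inner ℝ y (B x) := by
      intro x
      rw [inner_zero_left, real_inner_comm]
      exact ((Submodule.mem_orthogonal _ _).1 hy (B x) ⟨x, rfl⟩).symm
    have hmem : y ∈ B.adjoint.domain := LinearPMap.mem_adjoint_domain_of_exists y ⟨0, hy'⟩
    have hval := LinearPMap.adjoint_apply_eq hdense ⟨y, hmem⟩ hy'
    have hgr : (y, (0 : H)) ∈ B.graph := by
      rw [← hadj, LinearPMap.mem_graph_iff]
      exact ⟨⟨y, hmem⟩, rfl, hval⟩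
    obtain ⟨x', h1, h2⟩ := (LinearPMap.mem_graph_iff _).1 hgr
    have := hinj x' h2
    have h1' : (x' : H) = y := h1
    rw [← h1', this]; rfl
  have htop : P = ⊤ := by
    have : IsClosed (P : Set H) := hclosed
    have : CompleteSpace P := this.completeSpace_coe
    exact (Submodule.orthogonal_eq_bot_iff).1 horth
  have hsurj : ∀ y : H, ∃ x : B.domain, B x = y := by
    intro y
    have : y ∈ P := htop ▸ Submodule.mem_top
    exact this
  choose f hf using hsurj
  have huniq : ∀ x x' : B.domain, B x = B x' → x = x' := by
    intro x x' h
    have := hinj (x - x') (by rw [LinearPMap.map_sub, h, sub_self])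
    exact sub_eq_zero.1 this
  let T0 : H →ₗ[ℝ] H :=
    { toFun := fun y => (f y : H)
      map_add' := fun y z => by
        rw [← Submodule.coe_add]
        exact congrArg _ (huniq _ _ (by rw [LinearPMap.map_add, hf, hf, hf]))
      map_smul' := fun a y => by
        rw [RingHom.id_apply, ← Submodule.coe_smul]
        exact congrArg _ (huniq _ _ (by rw [LinearPMap.map_smul, hf, hf])) }
  refine ⟨T0.mkContinuous b⁻¹ fun y => ?_, fun x y => ?_⟩
  · have := hlow (f y)
    rw [hf] at this
    change ‖(f y : H)‖ ≤ _
    rw [inv_mul_eq_div, le_div_iff₀ hb]; linarith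
  · rw [LinearPMap.mem_graph_iff]
    constructor
    · rintro ⟨x', h1, h2⟩
      have h1' : (x' : H) = x := h1
      rw [← h1']
      exact congrArg _ (huniq _ _ (by rw [hf]; exact h2))
    · intro h
      exact ⟨f y, h.symm, hf y⟩

/-- The bounded inverse has a nonnegative self-adjoint bounded square root. -/
theorem exists_sqrt_inverse {B : H →ₗ.[ℝ] H} {b : ℝ} (hB : IsSelfAdjoint B) (hb : 0 < b)
    (hcoer : CoerciveWith B b) :
    ∃ R : H →L[ℝ] H, IsSelfAdjoint R ∧ (∀ x, 0 ≤ inner ℝ (R x) x) ∧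
      (∀ x y, (x, y) ∈ B.graph ↔ x = R (R y)) ∧
      ∀ Q : H →L[ℝ] H, (∀ x, Q (R (R x)) = R (R (Q x))) → ∀ x, Q (R x) = R (Q x) := by
  obtain ⟨T, hT⟩ := exists_inverse hB hb hcoer
  have hTmem : ∀ y, ∃ x : B.domain, (x : H) = T y ∧ B x = y := fun y =>
    (LinearPMap.mem_graph_iff _).1 ((hT (T y) y).2 rfl)
  have hTs : ∀ y z, inner ℝ (T y) z = inner ℝ y (T z) := by
    intro y z
    obtain ⟨x, hx, hBx⟩ := hTmem y
    obtain ⟨w, hw, hBw⟩ := hTmem z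
    have hadj : B.adjoint = B := hB
    have hfa := LinearPMap.adjoint_isFormalAdjoint (T := B) hB.dense_domain
    rw [hadj] at hfa
    rw [← hx, ← hw, ← hBx, ← hBw]
    exact (hfa x w).symm
  have hTsa : IsSelfAdjoint T := by
    rw [ContinuousLinearMap.isSelfAdjoint_iff_isSymmetric]
    exact hTs
  have hTb : ∀ y, b * ‖T y‖ ^ 2 ≤ inner ℝ (T y) y := by
    intro y
    obtain ⟨x, hx, hBx⟩ := hTmem y
    have := hcoer x
    rw [hx, hBx] at this
    rw [real_inner_comm]; exact this
  have hXn : ‖1 - b • T‖ ≤ 1 := by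
    refine ContinuousLinearMap.opNorm_le_bound _ zero_le_one fun y => ?_
    rw [one_mul]
    refine le_of_sq_le_sq ?_ (norm_nonneg _)
    have h1 : (1 - b • T) y = y - b • T y := rfl
    rw [h1, norm_sub_sq_real, norm_smul, Real.norm_of_nonneg hb.le, real_inner_smul_right,
      real_inner_comm]
    have h2 := hTb y
    have h3 : 0 ≤ inner ℝ (T y) y := le_trans (by positivity) h2
    nlinarith
  have hXs : IsSelfAdjoint (1 - b • T) :=
    (IsSelfAdjoint.one _).sub ((IsSelfAdjoint.all b).smul hTsa)
  obtain ⟨R, hRs, hRp, hRR, hRc⟩ := exists_sqrt_one_sub _ hXn hXs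
  have hbs : (√b)⁻¹ * (√b)⁻¹ = b⁻¹ := by
    rw [← mul_inv, Real.mul_self_sqrt hb.le]
  have hRRT : ∀ y, ((√b)⁻¹ • R) (((√b)⁻¹ • R) y) = T y := by
    intro y
    have h1 : R (R y) = b • T y := by
      have := congrArg (fun L : H →L[ℝ] H => L y) hRR
      simpa using this
    rw [smul_apply, smul_apply,
      ContinuousLinearMap.map_smul, smul_smul, hbs, h1, smul_smul, inv_mul_cancel₀ hb.ne', one_smul]
  refine ⟨(√b)⁻¹ • R, (IsSelfAdjoint.all _).smul hRs, fun x => ?_, fun x y => ?_, fun Q hQ => ?_⟩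
  · rw [smul_apply, real_inner_smul_left]
    exact mul_nonneg (by positivity) (hRp x)
  · rw [hRRT]; exact hT x y
  · have h1 : Commute Q (1 - b • T) := by
      refine (Commute.one_right Q).sub_right (Commute.smul_right ?_ b)
      ext x
      have := hQ x
      rw [hRRT, hRRT] at this
      exact this
    intro x
    have h2 := congrArg (fun L : H →L[ℝ] H => L x) (hRc Q h1).eq
    have h3 : Q (R x) = R (Q x) := h2
    rw [smul_apply, ContinuousLinearMap.map_smul, h3,
      smul_apply]

/-- Every self-adjoint coercive operator has a nonnegative self-adjoint square root. -/
theorem exists_isNonnegSqrt {B : H →ₗ.[ℝ] H} {b : ℝ} (hB : IsSelfAdjoint B) (hb : 0 < b)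
    (hcoer : CoerciveWith B b) : ∃ S, IsNonnegSqrt B S := by
  obtain ⟨R, hRs, hRp, hRB, -⟩ := exists_sqrt_inverse hB hb hcoer
  have hsymm : ∀ x y, inner ℝ (R x) y = inner ℝ x (R y) :=
    (ContinuousLinearMap.isSelfAdjoint_iff_isSymmetric).1 hRs
  have hinj : ∀ x, R x = 0 → x = 0 := by
    intro x hx
    have : ((0 : H), x) ∈ B.graph := (hRB 0 x).2 (by rw [hx, map_zero])
    exact B.graph_fst_eq_zero_snd this rfl
  let g : Submodule ℝ (H × H) :=
    { carrier := {p | p.1 = R p.2}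
      add_mem' := fun {p q} hp hq => by
        change p.1 + q.1 = R (p.2 + q.2)
        rw [map_add, show p.1 = R p.2 from hp, show q.1 = R q.2 from hq]
      zero_mem' := by change (0 : H) = R 0; simp
      smul_mem' := fun a p hp => by
        change a • p.1 = R (a • p.2)
        rw [map_smul, show p.1 = R p.2 from hp] }
  have hg : ∀ x ∈ g, x.1 = 0 → x.2 = 0 := by
    intro x hx h0
    exact hinj _ ((show x.1 = R x.2 from hx).symm.trans h0)
  set S : H →ₗ.[ℝ] H := g.toLinearPMap with hS
  have hgraph : ∀ x z, (x, z) ∈ S.graph ↔ x = R z := by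
    intro x z
    rw [hS, Submodule.toLinearPMap_graph_eq g hg]
    rfl
  have hdom : ∀ z, R z ∈ S.domain := fun z =>
    LinearPMap.mem_domain_of_mem_graph ((hgraph (R z) z).2 rfl)
  have happ : ∀ x : S.domain, (x : H) = R (S x) := fun x => (hgraph _ _).1 (S.mem_graph x)
  have happ' : ∀ z, S ⟨R z, hdom z⟩ = z := by
    intro z
    have h := happ ⟨R z, hdom z⟩
    have := hinj (z - S ⟨R z, hdom z⟩) (by rw [map_sub, ← h, sub_self])
    exact (sub_eq_zero.1 this).symm
  have hdense : Dense (S.domain : Set H) := by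
    rw [Submodule.dense_iff_topologicalClosure_eq_top, Submodule.topologicalClosure_eq_top_iff,
      Submodule.eq_bot_iff]
    intro y hy
    refine hinj y ((inner_self_eq_zero (𝕜 := ℝ)).1 ?_)
    rw [← hsymm]
    exact (Submodule.mem_orthogonal _ _).1 hy _ (hdom (R y))
  refine ⟨S, ?_, ?_, ?_⟩
  · rw [LinearPMap.isSelfAdjoint_def]
    refine LinearPMap.eq_of_eq_graph ?_
    rw [LinearPMap.adjoint_graph_eq_graph_adjoint hdense]
    ext ⟨x, w⟩
    rw [hgraph, Submodule.mem_adjoint_iff]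
    constructor
    · intro h
      refine ext_inner_left ℝ fun z => ?_
      have := h (R z) z ((hgraph _ _).2 rfl)
      rw [sub_eq_zero] at this
      rw [← hsymm]; exact this
    · rintro h a z haz
      rw [hgraph] at haz
      change inner ℝ z x - inner ℝ a w = 0
      rw [haz, h, hsymm, sub_self]
  · intro x
    have h := hRp (S x)
    rw [← happ, real_inner_comm] at h
    exact h
  · intro x y
    rw [hRB]
    constructor
    · intro h
      exact ⟨R y, (hgraph _ _).2 h, (hgraph _ _).2 rfl⟩
    · rintro ⟨z, h1, h2⟩
      rw [hgraph] at h1 h2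
      rw [h1, h2]

/-- The nonnegative self-adjoint square root of a self-adjoint coercive operator is unique. -/
theorem IsNonnegSqrt.unique {B S S' : H →ₗ.[ℝ] H} {b : ℝ} (hB : IsSelfAdjoint B) (hb : 0 < b)
    (hcoer : CoerciveWith B b) (hS : IsNonnegSqrt B S) (hS' : IsNonnegSqrt B S') : S = S' := by
  obtain ⟨R, hRs, hRp, hRB, hRc⟩ := exists_sqrt_inverse hB hb hcoer
  have hsymm : ∀ x y, inner ℝ (R x) y = inner ℝ x (R y) :=
    (ContinuousLinearMap.isSelfAdjoint_iff_isSymmetric).1 hRs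
  have hinj : ∀ x, R x = 0 → x = 0 := by
    intro x hx
    have : ((0 : H), x) ∈ B.graph := (hRB 0 x).2 (by rw [hx, map_zero])
    exact B.graph_fst_eq_zero_snd this rfl
  have hnull : ∀ y, inner ℝ (R y) y = 0 → y = 0 := by
    intro y hy
    refine hinj y ?_
    set a := ‖R y‖ ^ 2 with ha
    set k := inner ℝ (R (R y)) (R y) with hk
    have hk0 : 0 ≤ k := hRp (R y)
    have ha0 : 0 ≤ a := by positivity
    have key : ∀ t : ℝ, 0 ≤ 2 * t * a + t ^ 2 * k := by
      intro t
      have h := hRp (y + t • R y)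
      rw [map_add, map_smul, inner_add_left, inner_add_right, inner_add_right,
        real_inner_smul_left, real_inner_smul_left, real_inner_smul_right, real_inner_smul_right,
        hy, hsymm (R y) y, real_inner_self_eq_norm_sq] at h
      rw [ha, hk]
      linarith
    have h1 := key (-(a / (k + 1)))
    have h2 : 2 * (-(a / (k + 1))) * a + (-(a / (k + 1))) ^ 2 * k
        = -(a ^ 2 * (k + 2)) / (k + 1) ^ 2 := by
      field_simp
      ring
    rw [h2, le_div_iff₀ (by positivity)] at h1
    have h3 : a ^ 2 = 0 := by nlinarith [sq_nonneg a]
    have h4 : ‖R y‖ = 0 := by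
      rw [ha] at h3
      exact pow_eq_zero_iff (two_ne_zero) |>.1 (pow_eq_zero_iff two_ne_zero |>.1 h3)
    exact norm_eq_zero.1 h4
  suffices h : ∀ S : H →ₗ.[ℝ] H, IsNonnegSqrt B S → ∀ x z, (x, z) ∈ S.graph ↔ x = R z by
    refine LinearPMap.eq_of_eq_graph ?_
    ext ⟨x, z⟩
    rw [h S hS, h S' hS']
  intro S hS
  have hadj : S.adjoint = S := hS.isSelfAdjoint
  have hfa := LinearPMap.adjoint_isFormalAdjoint (T := S) hS.isSelfAdjoint.dense_domain
  rw [hadj] at hfa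
  have hfa' : ∀ x z x' z', (x, z) ∈ S.graph → (x', z') ∈ S.graph →
      inner ℝ z x' = inner ℝ x z' := by
    intro x z x' z' h h'
    obtain ⟨p, hp1, hp2⟩ := (LinearPMap.mem_graph_iff _).1 h
    obtain ⟨q, hq1, hq2⟩ := (LinearPMap.mem_graph_iff _).1 h'
    have := hfa p q
    rw [← show (p : H) = x from hp1, ← show S p = z from hp2, ← show (q : H) = x' from hq1,
      ← show S q = z' from hq2]
    exact this
  have hSinj : ∀ x, (x, (0 : H)) ∈ S.graph → x = 0 := by
    intro x hx
    have : (x, (0 : H)) ∈ B.graph := (hS.sq_eq x 0).2 ⟨0, hx, S.graph.zero_mem⟩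
    rw [hRB] at this
    simpa using this
  have hSuniq : ∀ x x' z, (x, z) ∈ S.graph → (x', z) ∈ S.graph → x = x' := by
    intro x x' z h h'
    have := S.graph.sub_mem h h'
    rw [Prod.mk_sub_mk, sub_self] at this
    exact sub_eq_zero.1 (hSinj _ this)
  have hex : ∀ y, ∃ z, (R (R y), z) ∈ S.graph ∧ (z, y) ∈ S.graph := fun y =>
    (hS.sq_eq _ _).1 ((hRB _ _).2 rfl)
  choose f hf1 hf2 using hex
  let Q0 : H →ₗ[ℝ] H :=
    { toFun := f
      map_add' := fun y z => hSuniq _ _ _ (hf2 (y + z)) (S.graph.add_mem (hf2 y) (hf2 z))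
      map_smul' := fun a y => hSuniq _ _ _ (hf2 (a • y)) (S.graph.smul_mem a (hf2 y)) }
  have hQsymm : Q0.IsSymmetric := fun y w => (hfa' _ _ _ _ (hf2 y) (hf2 w)).symm
  let Q : H →L[ℝ] H := ⟨Q0, hQsymm.continuous⟩
  have hQf : ∀ y, Q y = f y := fun _ => rfl
  have hQQ : ∀ y, Q (Q y) = R (R y) := fun y => hSuniq _ _ _ (hf2 (f y)) (hf1 y)
  have hQp : ∀ y, 0 ≤ inner ℝ (Q y) y := by
    intro y
    obtain ⟨p, hp1, hp2⟩ := (LinearPMap.mem_graph_iff _).1 (hf2 y)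
    have := hS.nonneg p
    rw [show (p : H) = f y from hp1, show S p = y from hp2, real_inner_comm] at this
    exact this
  have hQR : ∀ x, Q (R x) = R (Q x) := hRc Q fun x => by rw [← hQQ, ← hQQ]
  have heq : ∀ x, R x = Q x := by
    intro x
    have h1 : R (R x - Q x) + Q (R x - Q x) = 0 := by
      rw [map_sub, map_sub, hQR, hQQ]; abel
    have h2 : inner ℝ (R (R x - Q x)) (R x - Q x) + inner ℝ (Q (R x - Q x)) (R x - Q x) = 0 := by
      rw [← inner_add_left, h1, inner_zero_left]
    have h3 := hRp (R x - Q x)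
    have h4 := hQp (R x - Q x)
    exact sub_eq_zero.1 (hnull _ (by linarith))
  intro x z
  rw [heq, hQf]
  exact ⟨fun h => hSuniq _ _ _ h (hf2 z), fun h => h ▸ hf2 z⟩

open Classical in
/-- The square root `B^{1/2}` of a nonnegative self-adjoint operator `B`: the nonnegative
self-adjoint operator whose square is `B`. -/
noncomputable def sqrtOp (B : H →ₗ.[ℝ] H) : H →ₗ.[ℝ] H :=
  if h : ∃ S, IsNonnegSqrt B S then h.choose else ⊥

/-- For self-adjoint coercive `B`, the operator `sqrtOp B` is a genuine square root of `B`. -/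
theorem isNonnegSqrt_sqrtOp {B : H →ₗ.[ℝ] H} {b : ℝ} (hB : IsSelfAdjoint B) (hb : 0 < b)
    (hcoer : CoerciveWith B b) : IsNonnegSqrt B (sqrtOp B) := by
  have h := exists_isNonnegSqrt hB hb hcoer
  rw [sqrtOp, dif_pos h]
  exact h.choose_spec

end SquareRoot

/-! ### Energy solutions of `u'' + (B + A(t)) u + γ u' = 0` on `[0, ∞)` -/

section Evolution

open Set MeasureTheory

variable {H : Type*} [NormedAddCommGroup H] [InnerProductSpace ℝ H] [CompleteSpace H]

/-- The energy space `V = D(B^{1/2})`. -/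
noncomputable abbrev EnergySpace (B : H →ₗ.[ℝ] H) : Submodule ℝ H := (sqrtOp B).domain

/-- The norm `‖v‖ = |B^{1/2} v|` of `V`. -/
noncomputable def energyNorm (B : H →ₗ.[ℝ] H) (v : EnergySpace B) : ℝ := ‖sqrtOp B v‖

/-- The duality pairing `⟨B u, v⟩` of `V'` and `V`, for the extension of `B` to an operator from
`V` to its dual `V'`. -/
noncomputable def energyForm (B : H →ₗ.[ℝ] H) (u v : EnergySpace B) : ℝ :=
  inner ℝ (sqrtOp B u) (sqrtOp B v)

/-- `u` is a solution, with derivative `u'`, of `u'' + (B + A(t)) u + γ u' = 0` on `[0, ∞)`, in the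
class `C([0, ∞), V) ∩ C¹([0, ∞), H) ∩ W^{2,∞}_loc([0, ∞), V')`. The initial data `u 0 ∈ V` and
`u' 0 ∈ H` are arbitrary. Only the values of `u` and `u'` at times `t ≥ 0` matter. -/
structure IsEnergySolution (B : H →ₗ.[ℝ] H) (A : ℝ → H →L[ℝ] H) (γ : H →L[ℝ] H)
    (u : ℝ → EnergySpace B) (u' : ℝ → H) : Prop where
  /-- `u` is continuous with values in `V`. -/
  continuousOn : ContinuousOn (fun t => sqrtOp B (u t)) (Ici 0)
  /-- `u` is continuously differentiable with values in `H`, and its derivative is `u'`. -/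
  hasDerivWithinAt : ∀ t, 0 ≤ t → HasDerivWithinAt (fun τ => (u τ : H)) (u' t) (Ici 0) t
  continuousOn_deriv : ContinuousOn u' (Ici 0)
  /-- `u'`, seen in the dual `V'` of `V` through the inner product of `H`, is locally Lipschitz,
  that is, `u''` belongs to `L^∞_loc([0, ∞), V')`. -/
  lipschitz_dual : ∀ T : ℝ, ∃ K : ℝ, ∀ s ∈ Icc 0 T, ∀ t ∈ Icc 0 T, ∀ v : EnergySpace B,
    |inner ℝ (u' t - u' s) (v : H)| ≤ K * |t - s| * energyNorm B v
  /-- The equation holds in `V'` almost everywhere. -/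
  equation : ∀ v : EnergySpace B, ∀ᵐ t ∂(volume.restrict (Ici (0 : ℝ))),
    HasDerivAt (fun τ => inner ℝ (u' τ) (v : H))
      (-(energyForm B (u t) v + inner ℝ (A t (u t : H)) (v : H) + inner ℝ (γ (u' t)) (v : H))) t

end Evolution

end DissipativeEvolution

/-!
The proof is an energy method for the functional
`Φ = ‖u‖² + |u'|² + c (u, u') + (c²/2) |u|² = ‖u‖² + (c²/4) |u|² + |u' + (c/2) u|²`,
which is comparable with `‖u‖² + |u'|²`. Along solutions, formally,
`Φ' = -c |u'|² - c ‖u‖² - 2 (A u, u' + (c/2) u)`, and with `a = ‖A‖`, `‖u‖² ≥ b |u|²` the right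
hand side is at most `-(c |u'|² - 2 a |u| |u'| + c (b - a) |u|²)`. This quadratic form is positive
definite exactly when `a² < c² (b - a)`, which is the assumption `a < c √(b + c²/4) - c²/2`. Some
room is left, so that `Φ' ≤ -δ Φ` with `δ > 0` depending on `a`, `b`, `c` only
(`energyRate_le`, `modifiedEnergy_le`), and Gronwall's inequality gives the decay
(`le_mul_exp_of_sub_le_integral`).

The point to be justified is the formula for `Φ'`, since `u''` has values in `V'` only and `u'` is
not in `V`. Everything is expressed by the bounded injective operator `R = B^{-1/2}`
(`exists_inverse_sqrtOp`) and by `y = B^{1/2} u`, so that `u = R y`. The weak equation says that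
`R u'` is Lipschitz and it integrates to
`R u'(t) - R u'(s) = -∫ (y + R A R y + c R u')` (`IsReducedSolution.sub_eq_integral`), so that
`R u'` is differentiable almost everywhere by the Lebesgue differentiation theorem. Let
`Q = (R + ε)⁻¹`. Then `R Q y = Q u` is continuously differentiable and `Q R u'` is Lipschitz and
a.e. differentiable, so the formula holds in integrated form for the solution smoothed by `R Q`
(`IsReducedSolution.smoothed_energy_identity`). As `ε → 0` the contractions `R Q` tend strongly to
the identity (`exists_approx_inverse`), and dominated convergence gives the identity for the
solution itself (`IsReducedSolution.energy_identity`).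
-/

namespace DissipativeEvolution

open MeasureTheory Set Filter Topology

/-! ### The inverse square root and its approximate inverses -/

section Operators

variable {H : Type*} [NormedAddCommGroup H] [InnerProductSpace ℝ H]

/-- The range of an injective symmetric operator is dense. -/
theorem exists_norm_sub_apply_lt [CompleteSpace H] {R : H →L[ℝ] H}
    (hsymm : ∀ x y, inner ℝ (R x) y = inner ℝ x (R y)) (hinj : ∀ x, R x = 0 → x = 0)
    (x : H) {ε : ℝ} (hε : 0 < ε) : ∃ z, ‖x - R z‖ < ε := by
  have hdense : Dense (LinearMap.range (R : H →ₗ[ℝ] H) : Set H) := by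
    rw [Submodule.dense_iff_topologicalClosure_eq_top, Submodule.topologicalClosure_eq_top_iff,
      Submodule.eq_bot_iff]
    intro y hy
    refine hinj y ((inner_self_eq_zero (𝕜 := ℝ)).1 ?_)
    rw [← hsymm]
    exact (Submodule.mem_orthogonal _ _).1 hy _ ⟨R y, rfl⟩
  obtain ⟨_, ⟨z, rfl⟩, hz⟩ := Metric.mem_closure_iff.1 (hdense x) ε hε
  exact ⟨z, by rwa [dist_eq_norm] at hz⟩

/-- The square root of `B` is the inverse of a bounded operator `R = B^{-1/2}`, and the
coercivity of `B` becomes the bound `b |R x|² ≤ |x|²`. -/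
theorem exists_inverse_sqrtOp [CompleteSpace H] {B : H →ₗ.[ℝ] H} {b : ℝ} (hB : IsSelfAdjoint B)
    (hb : 0 < b) (hcoer : CoerciveWith B b) :
    ∃ R : H →L[ℝ] H, (∀ x y, inner ℝ (R x) y = inner ℝ x (R y)) ∧ (∀ x, R x = 0 → x = 0) ∧
      (∀ x, 0 ≤ inner ℝ (R x) x) ∧ (∀ x, b * ‖R x‖ ^ 2 ≤ ‖x‖ ^ 2) ∧
      ∀ x z, (x, z) ∈ (sqrtOp B).graph ↔ x = R z := by
  have hS := isNonnegSqrt_sqrtOp hB hb hcoer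
  set S := sqrtOp B
  obtain ⟨T, hT⟩ := exists_inverse hB hb hcoer
  have hadj : S.adjoint = S := hS.isSelfAdjoint
  have hfa := LinearPMap.adjoint_isFormalAdjoint (T := S) hS.isSelfAdjoint.dense_domain
  rw [hadj] at hfa
  have hfa' : ∀ x z x' z', (x, z) ∈ S.graph → (x', z') ∈ S.graph →
      inner ℝ z x' = inner ℝ x z' := by
    intro x z x' z' h h'
    obtain ⟨p, hp1, hp2⟩ := (LinearPMap.mem_graph_iff _).1 h
    obtain ⟨q, hq1, hq2⟩ := (LinearPMap.mem_graph_iff _).1 h'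
    have := hfa p q
    rw [← show (p : H) = x from hp1, ← show S p = z from hp2, ← show (q : H) = x' from hq1,
      ← show S q = z' from hq2]
    exact this
  have hSinj : ∀ x, (x, (0 : H)) ∈ S.graph → x = 0 := by
    intro x hx
    have : (x, (0 : H)) ∈ B.graph := (hS.sq_eq x 0).2 ⟨0, hx, S.graph.zero_mem⟩
    rw [hT] at this
    simpa using this
  have hSuniq : ∀ x x' z, (x, z) ∈ S.graph → (x', z) ∈ S.graph → x = x' := by
    intro x x' z h h'
    have := S.graph.sub_mem h h'
    rw [Prod.mk_sub_mk, sub_self] at this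
    exact sub_eq_zero.1 (hSinj _ this)
  have hex : ∀ y, ∃ z, (T y, z) ∈ S.graph ∧ (z, y) ∈ S.graph := fun y =>
    (hS.sq_eq _ _).1 ((hT _ _).2 rfl)
  choose f hf1 hf2 using hex
  let R0 : H →ₗ[ℝ] H :=
    { toFun := f
      map_add' := fun y z => hSuniq _ _ _ (hf2 (y + z)) (S.graph.add_mem (hf2 y) (hf2 z))
      map_smul' := fun a y => hSuniq _ _ _ (hf2 (a • y)) (S.graph.smul_mem a (hf2 y)) }
  have hR0 : R0.IsSymmetric := fun y w => (hfa' _ _ _ _ (hf2 y) (hf2 w)).symm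
  -- everywhere defined and symmetric, hence bounded by the Hellinger–Toeplitz theorem
  let R : H →L[ℝ] H := ⟨R0, hR0.continuous⟩
  have hRg : ∀ y, (R y, y) ∈ S.graph := hf2
  have hsymm : ∀ x y, inner ℝ (R x) y = inner ℝ x (R y) := hR0
  have hinj : ∀ x, R x = 0 → x = 0 := fun x hx =>
    S.graph_fst_eq_zero_snd (hRg x) hx
  have hpos : ∀ y, 0 ≤ inner ℝ (R y) y := by
    intro y
    obtain ⟨p, hp1, hp2⟩ := (LinearPMap.mem_graph_iff _).1 (hRg y)
    have := hS.nonneg p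
    rw [show (p : H) = R y from hp1, show S p = y from hp2, real_inner_comm] at this
    exact this
  refine ⟨R, hsymm, hinj, hpos, fun x => ?_, fun x z => ?_⟩
  · -- the inequality is the coercivity of `B` on the range of `R`, which is dense
    have hran : ∀ y, b * ‖R (R y)‖ ^ 2 ≤ ‖R y‖ ^ 2 := by
      intro y
      have hg : (R (R y), y) ∈ B.graph := (hS.sq_eq _ _).2 ⟨R y, hRg _, hRg _⟩
      obtain ⟨p, hp1, hp2⟩ := (LinearPMap.mem_graph_iff _).1 hg
      have := hcoer p
      rw [show (p : H) = R (R y) from hp1, show B p = y from hp2, ← hsymm,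
        real_inner_self_eq_norm_sq] at this
      exact this
    have hcl : IsClosed {x : H | b * ‖R x‖ ^ 2 ≤ ‖x‖ ^ 2} :=
      isClosed_le (by fun_prop) (by fun_prop)
    have hx : x ∈ closure {x : H | b * ‖R x‖ ^ 2 ≤ ‖x‖ ^ 2} := by
      refine Metric.mem_closure_iff.2 fun ε hε => ?_
      obtain ⟨z, hz⟩ := exists_norm_sub_apply_lt hsymm hinj x hε
      exact ⟨R z, hran z, by rwa [dist_eq_norm]⟩
    rwa [hcl.closure_eq] at hx
  · exact ⟨fun h => hSuniq _ _ _ h (hRg z), fun h => h ▸ hRg z⟩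

/-- The resolvent of a bounded nonnegative symmetric operator. -/
theorem exists_resolvent [CompleteSpace H] {R : H →L[ℝ] H}
    (hpos : ∀ x, 0 ≤ inner ℝ (R x) x) {ε : ℝ} (hε : 0 < ε) :
    ∃ Q : H →L[ℝ] H, (∀ x, R (Q x) + ε • Q x = x) ∧ (∀ x, Q (R x) + ε • Q x = x) := by
  set F : H →L[ℝ] H := R + ε • ContinuousLinearMap.id ℝ H with hF
  have hco : IsCoercive ((innerSL ℝ : H →L[ℝ] H →L[ℝ] ℝ).comp F) := by
    refine ⟨ε, hε, fun x => ?_⟩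
    have h := hpos x
    simp only [hF, ContinuousLinearMap.comp_apply, innerSL_apply_apply, _root_.add_apply,
      _root_.smul_apply, ContinuousLinearMap.id_apply, inner_add_left,
      real_inner_smul_left, real_inner_self_eq_norm_mul_norm]
    nlinarith
  set e := hco.continuousLinearEquivOfBilin with he
  have heF : ∀ x, e x = R x + ε • x := by
    intro x
    refine ext_inner_right ℝ fun w => ?_
    rw [he, IsCoercive.continuousLinearEquivOfBilin_apply]
    rfl
  refine ⟨e.symm, fun x => ?_, fun x => ?_⟩
  · have := e.apply_symm_apply x
    rw [heF] at this
    exact this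
  · have := e.symm_apply_apply x
    rw [heF, map_add, map_smul] at this
    exact this

/-- A bounded injective nonnegative symmetric operator `R` has approximate inverses `Q n`,
commuting with `R`: the contractions `R ∘ Q n` converge strongly to the identity. -/
theorem exists_approx_inverse [CompleteSpace H] {R : H →L[ℝ] H}
    (hsymm : ∀ x y, inner ℝ (R x) y = inner ℝ x (R y)) (hinj : ∀ x, R x = 0 → x = 0)
    (hpos : ∀ x, 0 ≤ inner ℝ (R x) x) :
    ∃ Q : ℕ → H →L[ℝ] H, (∀ n x, Q n (R x) = R (Q n x)) ∧
      (∀ n x, ‖R (Q n x)‖ ≤ ‖x‖) ∧ ∀ x, Tendsto (fun n => R (Q n x)) atTop (𝓝 x) := by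
  have hε : ∀ n : ℕ, (0 : ℝ) < 1 / ((n : ℝ) + 1) := fun n => by positivity
  choose Q hQ1 hQ2 using fun n => exists_resolvent hpos (hε n)
  have hsq : ∀ n x, ‖R (Q n x)‖ ^ 2 + (1 / ((n : ℝ) + 1)) ^ 2 * ‖Q n x‖ ^ 2 ≤ ‖x‖ ^ 2 := by
    intro n x
    conv_rhs => rw [← hQ1 n x]
    rw [norm_add_sq_real, norm_smul, Real.norm_of_nonneg (hε n).le, real_inner_smul_right, mul_pow]
    have := mul_nonneg (hε n).le (hpos (Q n x))
    linarith
  have hQn : ∀ (n : ℕ) x, 1 / ((n : ℝ) + 1) * ‖Q n x‖ ≤ ‖x‖ := by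
    intro n x
    refine le_of_sq_le_sq ?_ (norm_nonneg _)
    have := hsq n x
    rw [mul_pow]
    nlinarith [sq_nonneg ‖R (Q n x)‖]
  have hRQ : ∀ n x, ‖R (Q n x)‖ ≤ ‖x‖ := by
    intro n x
    refine le_of_sq_le_sq ?_ (norm_nonneg _)
    have := hsq n x
    have h0 : 0 ≤ (1 / ((n : ℝ) + 1)) ^ 2 * ‖Q n x‖ ^ 2 := by positivity
    linarith
  have hcomm : ∀ n x, Q n (R x) = R (Q n x) := fun n x =>
    add_right_cancel ((hQ2 n x).trans (hQ1 n x).symm)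
  refine ⟨Q, hcomm, hRQ, fun x => ?_⟩
  · rw [Metric.tendsto_atTop]
    intro η hη
    obtain ⟨z, hz⟩ := exists_norm_sub_apply_lt hsymm hinj x (half_pos hη)
    obtain ⟨N, hN⟩ := exists_nat_gt (‖z‖ / (η / 2))
    refine ⟨N, fun n hn => ?_⟩
    -- `x - R (Q x) = ε Q x`, which is at most `|x - R z| + ε |z|`
    have h1 : x - R (Q n x) = (1 / ((n : ℝ) + 1)) • Q n (x - R z)
        + (1 / ((n : ℝ) + 1)) • R (Q n z) := by
      rw [← smul_add, ← hcomm n z, ← map_add, sub_add_cancel]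
      exact sub_eq_of_eq_add' (hQ1 n x).symm
    rw [dist_comm, dist_eq_norm, h1]
    have h2 : ‖(1 / ((n : ℝ) + 1)) • Q n (x - R z)‖ < η / 2 := by
      rw [norm_smul, Real.norm_of_nonneg (hε n).le]
      exact (hQn n _).trans_lt hz
    have h3 : ‖(1 / ((n : ℝ) + 1)) • R (Q n z)‖ ≤ η / 2 := by
      rw [norm_smul, Real.norm_of_nonneg (hε n).le]
      refine (mul_le_mul_of_nonneg_left (hRQ n z) (hε n).le).trans ?_
      rw [div_lt_iff₀ (half_pos hη)] at hN
      have hn' : (N : ℝ) ≤ n := by exact_mod_cast hn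
      rw [one_div, inv_mul_le_iff₀ (by positivity)]
      nlinarith
    linarith [norm_add_le ((1 / ((n : ℝ) + 1)) • Q n (x - R z)) ((1 / ((n : ℝ) + 1)) • R (Q n z))]

end Operators

/-! ### Real-variable lemmas -/

section RealVariable

variable {H : Type*} [NormedAddCommGroup H] [InnerProductSpace ℝ H]

theorem absolutelyContinuousOnInterval_inner {f g : ℝ → H} {s t K L : ℝ} (hst : s ≤ t)
    (hf : ∀ x ∈ Icc s t, ∀ y ∈ Icc s t, ‖f x - f y‖ ≤ K * |x - y|)
    (hg : ∀ x ∈ Icc s t, ∀ y ∈ Icc s t, ‖g x - g y‖ ≤ L * |x - y|) :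
    AbsolutelyContinuousOnInterval (fun x => inner ℝ (f x) (g x)) s t := by
  have hbd : ∀ {f : ℝ → H} {K : ℝ}, (∀ x ∈ Icc s t, ∀ y ∈ Icc s t, ‖f x - f y‖ ≤ K * |x - y|) →
      ∃ C, 0 ≤ C ∧ ∀ x ∈ Icc s t, ‖f x‖ ≤ C := by
    intro f K hf
    have hs : s ∈ Icc s t := ⟨le_rfl, hst⟩
    refine ⟨‖f s‖ + |K| * (t - s), by have := sub_nonneg.2 hst; positivity, fun x hx => ?_⟩
    have h1 := hf x hx s hs
    have h2 : |x - s| ≤ t - s := by rw [abs_of_nonneg (by linarith [hx.1])]; linarith [hx.2]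
    have h3 : K * |x - s| ≤ |K| * (t - s) :=
      mul_le_mul (le_abs_self K) h2 (abs_nonneg _) (abs_nonneg _)
    have h4 := norm_le_norm_add_norm_sub' (f x) (f s)
    linarith
  obtain ⟨C, hC0, hC⟩ := hbd hf
  obtain ⟨D, hD0, hD⟩ := hbd hg
  have hL : LipschitzOnWith (Real.toNNReal (|K| * D + C * |L|)) (fun x => inner ℝ (f x) (g x))
      (uIcc s t) := by
    refine LipschitzOnWith.of_dist_le_mul fun x hx y hy => ?_
    rw [uIcc_of_le hst] at hx hy
    rw [Real.coe_toNNReal _ (by positivity), Real.dist_eq, Real.dist_eq]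
    have h1 : inner ℝ (f x) (g x) - inner ℝ (f y) (g y)
        = inner ℝ (f x - f y) (g x) + inner ℝ (f y) (g x - g y) := by
      rw [inner_sub_left, inner_sub_right]; ring
    have h2 : |inner ℝ (f x - f y) (g x)| ≤ |K| * |x - y| * D :=
      (abs_real_inner_le_norm _ _).trans (mul_le_mul ((hf x hx y hy).trans
        (mul_le_mul_of_nonneg_right (le_abs_self K) (abs_nonneg _))) (hD x hx) (norm_nonneg _)
        (by positivity))
    have h3 : |inner ℝ (f y) (g x - g y)| ≤ C * (|L| * |x - y|) :=
      (abs_real_inner_le_norm _ _).trans (mul_le_mul (hC y hy) ((hg x hx y hy).trans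
        (mul_le_mul_of_nonneg_right (le_abs_self L) (abs_nonneg _))) (norm_nonneg _) hC0)
    rw [h1]
    refine (abs_add_le _ _).trans ?_
    linarith
  exact hL.absolutelyContinuousOnInterval

/-- A continuous function with `Φ t - Φ s ≤ -δ ∫ Φ` over every interval decays exponentially. -/
theorem le_mul_exp_of_sub_le_integral {Φ : ℝ → ℝ} {δ : ℝ} (hΦ : ContinuousOn Φ (Ici 0))
    (h : ∀ s t, 0 ≤ s → s ≤ t → Φ t - Φ s ≤ ∫ τ in s..t, -δ * Φ τ) {s t : ℝ} (hs : 0 ≤ s)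
    (hst : s ≤ t) : Φ t ≤ Φ s * Real.exp (-δ * (t - s)) := by
  rw [← gronwallBound_ε0]
  refine le_gronwallBound_of_liminf_deriv_right_le (f' := fun x => -δ * Φ x) (b := t)
    (hΦ.mono fun x hx => hs.trans hx.1) (fun x hx r hr => ?_) le_rfl (fun x _ => by simp) t
    ⟨hst, le_rfl⟩
  have hx0 : 0 ≤ x := hs.trans hx.1
  have hc : ContinuousOn (fun x => -δ * Φ x) (Icc x (x + 1)) :=
    (continuousOn_const.mul hΦ).mono fun z hz => hx0.trans hz.1
  have hint : HasDerivWithinAt (fun z => ∫ τ in x..z, -δ * Φ τ) (-δ * Φ x) (Ici x) x := by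
    have hc' : ContinuousOn (fun x => -δ * Φ x) (Ici x) :=
      (continuousOn_const.mul hΦ).mono fun z hz => hx0.trans hz
    refine intervalIntegral.integral_hasDerivWithinAt_right (by simp) (s := Ici x) (t := Ioi x) ?_
      ((hc' x self_mem_Ici).mono Ioi_subset_Ici_self)
    exact (hc'.mono Ioi_subset_Ici_self).stronglyMeasurableAtFilter_nhdsWithin measurableSet_Ioi x
  have hev := (hasDerivWithinAt_iff_tendsto_slope'  (by simp)).1
    (hint.mono Ioi_subset_Ici_self)
  refine ((hev.eventually_lt_const hr).and self_mem_nhdsWithin).frequently.mono fun z hz => ?_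
  obtain ⟨h1, h2⟩ := hz
  have h2' : x < z := h2
  rw [slope_def_field, intervalIntegral.integral_same, sub_zero] at h1
  refine lt_of_le_of_lt ?_ h1
  rw [inv_mul_eq_div]
  exact div_le_div_of_nonneg_right (h x z hx0 h2'.le) (by linarith)

/-- The hypothesis on the size of `A` is the positive definiteness of the quadratic form
`c v² - 2 a x v + c (b - a) x²`. -/
theorem sq_lt_of_lt_sqrt {a b c : ℝ} (ha : 0 ≤ a) (hc : 0 < c) (hb : 0 < b)
    (h : a < c * √(b + c ^ 2 / 4) - c ^ 2 / 2) : a ^ 2 < c ^ 2 * (b - a) := by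
  have h1 : a + c ^ 2 / 2 < c * √(b + c ^ 2 / 4) := by linarith
  have h2 := pow_lt_pow_left₀ h1 (by positivity) two_ne_zero
  rw [mul_pow, Real.sq_sqrt (by positivity)] at h2
  nlinarith

end RealVariable

/-! ### The energy identity -/

section EnergyIdentity

variable {H : Type*} [NormedAddCommGroup H] [InnerProductSpace ℝ H]

/-- The second derivative of `u = R y`, smoothed by `R = B^{-1/2}`: with `v = u'`, the equation
reads `(R v)' = smoothedForce`. -/
noncomputable def smoothedForce (R : H →L[ℝ] H) (A : ℝ → H →L[ℝ] H) (c : ℝ) (y v : ℝ → H)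
    (t : ℝ) : H :=
  -(y t + R (A t (R (y t))) + c • R (v t))

/-- The energy solutions of `u'' + (B + A(t)) u + c u' = 0`, written with the bounded operator
`R = B^{-1/2}` only: `y = B^{1/2} u`, `u = R y`, and `v = u'`. -/
structure IsReducedSolution (R : H →L[ℝ] H) (A : ℝ → H →L[ℝ] H) (c : ℝ) (y v : ℝ → H) : Prop where
  continuousOn : ContinuousOn y (Ici 0)
  hasDerivWithinAt : ∀ t, 0 ≤ t → HasDerivWithinAt (fun τ => R (y τ)) (v t) (Ici 0) t
  continuousOn_deriv : ContinuousOn v (Ici 0)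
  lipschitz : ∀ T : ℝ, ∃ K : ℝ, ∀ s ∈ Icc 0 T, ∀ t ∈ Icc 0 T, ‖R (v t) - R (v s)‖ ≤ K * |t - s|
  equation : ∀ w, ∀ᵐ t ∂(volume.restrict (Ici (0 : ℝ))),
    HasDerivAt (fun τ => inner ℝ w (R (v τ))) (inner ℝ w (smoothedForce R A c y v t)) t

/-- The functional `‖u‖² + |u'|² + c (u, u') + (c²/2) |u|²`, for `α = B^{1/2} u` and `β = u'`. -/
noncomputable def modifiedEnergy (R : H →L[ℝ] H) (c : ℝ) (α β : H) : ℝ :=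
  inner ℝ α α + inner ℝ β β + (c * inner ℝ (R α) β + c ^ 2 / 2 * inner ℝ (R α) (R α))

/-- The time derivative of `modifiedEnergy` along a solution, for `α = B^{1/2} u`, `β = u'` and
`z = A u`. -/
noncomputable def energyRate (R : H →L[ℝ] H) (c : ℝ) (α β z : H) : ℝ :=
  -c * inner ℝ β β - c * inner ℝ α α - 2 * inner ℝ z (β + (c / 2) • R α)

theorem continuous_modifiedEnergy (R : H →L[ℝ] H) (c : ℝ) :
    Continuous fun p : H × H => modifiedEnergy R c p.1 p.2 := by
  unfold modifiedEnergy; fun_prop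

theorem continuous_energyRate (R : H →L[ℝ] H) (c : ℝ) :
    Continuous fun p : H × H × H => energyRate R c p.1 p.2.1 p.2.2 := by
  unfold energyRate; fun_prop

theorem abs_energyRate_le (R : H →L[ℝ] H) {c N : ℝ} (hc : 0 < c) {α β z : H} (hα : ‖α‖ ≤ N)
    (hβ : ‖β‖ ≤ N) (hz : ‖z‖ ≤ N) :
    |energyRate R c α β z| ≤ c * N ^ 2 + c * N ^ 2 + 2 * (N * (N + c / 2 * (‖R‖ * N))) := by
  have hN : 0 ≤ N := (norm_nonneg _).trans hα
  have h1 : inner ℝ β β ≤ N ^ 2 := by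
    rw [real_inner_self_eq_norm_sq]; exact pow_le_pow_left₀ (norm_nonneg _) hβ 2
  have h2 : inner ℝ α α ≤ N ^ 2 := by
    rw [real_inner_self_eq_norm_sq]; exact pow_le_pow_left₀ (norm_nonneg _) hα 2
  have h3 : ‖β + (c / 2) • R α‖ ≤ N + c / 2 * (‖R‖ * N) := by
    refine (norm_add_le _ _).trans (add_le_add hβ ?_)
    rw [norm_smul, Real.norm_of_nonneg (by positivity)]
    gcongr
    exact (R.le_opNorm α).trans (by gcongr)
  have h4 : |inner ℝ z (β + (c / 2) • R α)| ≤ N * (N + c / 2 * (‖R‖ * N)) :=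
    (abs_real_inner_le_norm _ _).trans (mul_le_mul hz h3 (norm_nonneg _) hN)
  have h5 : 0 ≤ inner ℝ β β := real_inner_self_nonneg
  have h6 : 0 ≤ inner ℝ α α := real_inner_self_nonneg
  have h7 := mul_le_mul_of_nonneg_left h1 hc.le
  have h8 := mul_le_mul_of_nonneg_left h2 hc.le
  have h9 := mul_nonneg hc.le h5
  have h10 := mul_nonneg hc.le h6
  rw [abs_le] at h4 ⊢
  unfold energyRate
  constructor <;> linarith

/-- The pointwise computation behind the energy identity. Here `α = R q` and `β = R p` evolve by
`α' = p` and `β' = -(q + z + c β)`. The terms `(α, p)` and `(β, q)` cancel by the symmetry of `R`,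
which would be meaningless without the smoothing. -/
theorem deriv_modifiedEnergy_eq {R : H →L[ℝ] H}
    (hsymm : ∀ x y, inner ℝ (R x) y = inner ℝ x (R y)) (c : ℝ) (p q z : H) :
    (inner ℝ (R q) p + inner ℝ p (R q))
      + (inner ℝ (R p) (-(q + z + c • R p)) + inner ℝ (-(q + z + c • R p)) (R p))
      + (c * (inner ℝ (R (R q)) (-(q + z + c • R p)) + inner ℝ (R p) (R p))
      + c ^ 2 / 2 * (inner ℝ (R (R q)) (R p) + inner ℝ (R p) (R (R q))))
      = energyRate R c (R q) (R p) z := by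
  unfold energyRate
  simp only [inner_neg_left, inner_neg_right, inner_add_left, inner_add_right,
    real_inner_smul_left, real_inner_smul_right]
  have h1 : inner ℝ (R q) p = inner ℝ (R p) q := by rw [hsymm, real_inner_comm]
  have h2 : inner ℝ (R (R q)) q = inner ℝ (R q) (R q) := hsymm _ _
  rw [real_inner_comm (R q) p, real_inner_comm (R p) q, real_inner_comm (R p) z,
    real_inner_comm (R (R q)) z, real_inner_comm (R (R q)) (R p), h1, h2]
  ring

variable {R : H →L[ℝ] H} {A : ℝ → H →L[ℝ] H} {c a : ℝ} {y v : ℝ → H}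

theorem ae_of_ae_restrict_Ici {P : ℝ → Prop} (h : ∀ᵐ τ ∂(volume.restrict (Ici (0 : ℝ))), P τ) :
    ∀ᵐ τ, 0 ≤ τ → P τ :=
  (ae_restrict_iff' measurableSet_Ici).1 h

theorem intervalIntegrable_of_ae_bound {E : Type*} [NormedAddCommGroup E] {f : ℝ → E} {s t C : ℝ}
    (hs : 0 ≤ s) (hst : s ≤ t) (hf : AEStronglyMeasurable f (volume.restrict (Ici 0)))
    (hC : ∀ᵐ τ, τ ∈ Icc s t → ‖f τ‖ ≤ C) : IntervalIntegrable f volume s t := by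
  rw [intervalIntegrable_iff_integrableOn_Icc_of_le hst]
  refine IntegrableOn.of_bound (by simp)
    (hf.mono_measure (Measure.restrict_mono (fun x hx => hs.trans hx.1) le_rfl)) C ?_
  exact (ae_restrict_iff' measurableSet_Icc).2 hC

theorem IsReducedSolution.aestronglyMeasurable_perturbation (h : IsReducedSolution R A c y v)
    (hA : AEStronglyMeasurable A (volume.restrict (Ici 0))) :
    AEStronglyMeasurable (fun τ => A τ (R (y τ))) (volume.restrict (Ici 0)) :=
  isBoundedBilinearMap_apply.continuous.comp_aestronglyMeasurable (hA.prodMk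
    (R.continuous.comp_aestronglyMeasurable
      (h.continuousOn.aestronglyMeasurable measurableSet_Ici)))

theorem IsReducedSolution.exists_bound (h : IsReducedSolution R A c y v)
    (hAa : ∀ᵐ τ ∂(volume.restrict (Ici (0 : ℝ))), ‖A τ‖ ≤ a) {s t : ℝ} (hs : 0 ≤ s) :
    ∃ N, (∀ τ ∈ Icc s t, ‖y τ‖ ≤ N) ∧ (∀ τ ∈ Icc s t, ‖v τ‖ ≤ N) ∧
      ∀ᵐ τ, τ ∈ Icc s t → ‖A τ (R (y τ))‖ ≤ N := by
  have hsub : Icc s t ⊆ Ici 0 := fun x hx => hs.trans hx.1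
  obtain ⟨Y, hY⟩ := isCompact_Icc.exists_bound_of_continuousOn (h.continuousOn.mono hsub)
  obtain ⟨U, hU⟩ := isCompact_Icc.exists_bound_of_continuousOn (h.continuousOn_deriv.mono hsub)
  refine ⟨max (max Y U) (a * (‖R‖ * Y)), fun τ hτ => ?_, fun τ hτ => ?_, ?_⟩
  · exact (hY τ hτ).trans ((le_max_left _ _).trans (le_max_left _ _))
  · exact (hU τ hτ).trans ((le_max_right _ _).trans (le_max_left _ _))
  · filter_upwards [ae_of_ae_restrict_Ici hAa] with τ hτ hmem
    have ha := hτ (hsub hmem)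
    refine le_trans ?_ (le_max_right _ _)
    refine ((A τ).le_opNorm _).trans (mul_le_mul ha ?_ (norm_nonneg _) ((norm_nonneg _).trans ha))
    exact (R.le_opNorm _).trans (mul_le_mul_of_nonneg_left (hY τ hmem) (norm_nonneg _))

theorem IsReducedSolution.intervalIntegrable_smoothedForce (h : IsReducedSolution R A c y v)
    (hA : AEStronglyMeasurable A (volume.restrict (Ici 0)))
    (hAa : ∀ᵐ τ ∂(volume.restrict (Ici (0 : ℝ))), ‖A τ‖ ≤ a) {s t : ℝ} (hs : 0 ≤ s)
    (hst : s ≤ t) : IntervalIntegrable (smoothedForce R A c y v) volume s t := by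
  obtain ⟨N, hy, hv, hz⟩ := h.exists_bound hAa (t := t) hs
  have hm1 := h.continuousOn.aestronglyMeasurable (μ := volume) measurableSet_Ici
  have hm2 := h.continuousOn_deriv.aestronglyMeasurable (μ := volume) measurableSet_Ici
  refine intervalIntegrable_of_ae_bound (C := N + ‖R‖ * N + |c| * (‖R‖ * N)) hs hst
    ((hm1.add (R.continuous.comp_aestronglyMeasurable
      (h.aestronglyMeasurable_perturbation hA))).add
      ((R.continuous.comp_aestronglyMeasurable hm2).const_smul c)).neg ?_
  filter_upwards [hz] with τ hτ hmem
  have hR : ∀ x, ‖x‖ ≤ N → ‖R x‖ ≤ ‖R‖ * N := fun x hx =>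
    (R.le_opNorm x).trans (mul_le_mul_of_nonneg_left hx (norm_nonneg _))
  rw [smoothedForce, norm_neg]
  refine (norm_add₃_le).trans (add_le_add (add_le_add (hy τ hmem) (hR _ (hτ hmem))) ?_)
  rw [norm_smul, Real.norm_eq_abs]
  exact mul_le_mul_of_nonneg_left (hR _ (hv τ hmem)) (abs_nonneg _)

variable [CompleteSpace H]

/-- The weak equation, which holds for each test vector outside its own null set, integrates to an
identity between vectors. -/
theorem IsReducedSolution.sub_eq_integral (h : IsReducedSolution R A c y v)
    (hA : AEStronglyMeasurable A (volume.restrict (Ici 0)))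
    (hAa : ∀ᵐ τ ∂(volume.restrict (Ici (0 : ℝ))), ‖A τ‖ ≤ a) {s t : ℝ} (hs : 0 ≤ s)
    (hst : s ≤ t) : R (v t) - R (v s) = ∫ τ in s..t, smoothedForce R A c y v τ := by
  have hint := h.intervalIntegrable_smoothedForce hA hAa hs hst
  refine ext_inner_left ℝ fun w => ?_
  have hcomm := (innerSL ℝ w).intervalIntegral_comp_comm hint
  simp only [innerSL_apply_apply] at hcomm
  obtain ⟨K, hK⟩ := h.lipschitz t
  have hac : AbsolutelyContinuousOnInterval (fun τ => inner ℝ w (R (v τ))) s t :=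
    absolutelyContinuousOnInterval_inner (K := 0) (L := K) hst (by simp) fun x hx z hz =>
      hK z ⟨hs.trans hz.1, hz.2⟩ x ⟨hs.trans hx.1, hx.2⟩
  rw [← hcomm, inner_sub_right, ← hac.integral_deriv_eq_sub]
  refine intervalIntegral.integral_congr_ae ?_
  filter_upwards [ae_of_ae_restrict_Ici (h.equation w)] with τ hτ hmem
  rw [uIoc_of_le hst] at hmem
  exact (hτ (hs.trans hmem.1.le)).deriv

theorem IsReducedSolution.ae_hasDerivAt (h : IsReducedSolution R A c y v)
    (hA : AEStronglyMeasurable A (volume.restrict (Ici 0)))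
    (hAa : ∀ᵐ τ ∂(volume.restrict (Ici (0 : ℝ))), ‖A τ‖ ≤ a) {s t : ℝ} (hs : 0 ≤ s)
    (hst : s ≤ t) :
    ∀ᵐ τ, τ ∈ Ioo s t → HasDerivAt (fun τ => R (v τ)) (smoothedForce R A c y v τ) τ := by
  have hint := h.intervalIntegrable_smoothedForce hA hAa hs hst
  filter_upwards [hint.ae_hasDerivAt_integral] with τ hτ hmem
  have hd := hτ (by rw [uIcc_of_le hst]; exact Ioo_subset_Icc_self hmem) s (by simp)
  refine (hd.const_add (R (v s))).congr_of_eventuallyEq ?_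
  filter_upwards [Ioo_mem_nhds hmem.1 hmem.2] with x hx
  rw [← h.sub_eq_integral hA hAa hs hx.1.le, add_sub_cancel]

/-- The energy identity, after smoothing by `R ∘ Q`. -/
theorem IsReducedSolution.smoothed_energy_identity (h : IsReducedSolution R A c y v)
    (hA : AEStronglyMeasurable A (volume.restrict (Ici 0)))
    (hAa : ∀ᵐ τ ∂(volume.restrict (Ici (0 : ℝ))), ‖A τ‖ ≤ a)
    (hsymm : ∀ x y, inner ℝ (R x) y = inner ℝ x (R y)) {Q : H →L[ℝ] H}
    (hQ : ∀ x, Q (R x) = R (Q x)) {s t : ℝ} (hs : 0 ≤ s) (hst : s ≤ t) :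
    modifiedEnergy R c (R (Q (y t))) (R (Q (v t))) - modifiedEnergy R c (R (Q (y s))) (R (Q (v s)))
      = ∫ τ in s..t, energyRate R c (R (Q (y τ))) (R (Q (v τ))) (R (Q (A τ (R (y τ))))) := by
  have hsub : Icc s t ⊆ Ici 0 := fun x hx => hs.trans hx.1
  obtain ⟨U, hU⟩ := isCompact_Icc.exists_bound_of_continuousOn (h.continuousOn_deriv.mono hsub)
  have hu : ∀ x ∈ Icc s t, ∀ z ∈ Icc s t, ‖R (y x) - R (y z)‖ ≤ U * |x - z| := fun x hx z hz =>
    (convex_Icc s t).norm_image_sub_le_of_norm_hasDerivWithin_le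
      (fun r hr => (h.hasDerivWithinAt r (hsub hr)).mono hsub) hU hz hx
  obtain ⟨K, hK⟩ := h.lipschitz t
  have hv : ∀ x ∈ Icc s t, ∀ z ∈ Icc s t, ‖R (v x) - R (v z)‖ ≤ K * |x - z| := fun x hx z hz =>
    hK z ⟨hs.trans hz.1, hz.2⟩ x ⟨hs.trans hx.1, hx.2⟩
  have hlip : ∀ {g : ℝ → H} {L : ℝ} (F : H →L[ℝ] H),
      (∀ x ∈ Icc s t, ∀ z ∈ Icc s t, ‖g x - g z‖ ≤ L * |x - z|) →
      ∀ x ∈ Icc s t, ∀ z ∈ Icc s t, ‖F (g x) - F (g z)‖ ≤ (‖F‖ * L) * |x - z| := by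
    intro g L F hg x hx z hz
    rw [← map_sub, mul_assoc]
    exact (F.le_opNorm _).trans (mul_le_mul_of_nonneg_left (hg x hx z hz) (norm_nonneg _))
  have hα := hlip Q hu
  have hβ := hlip Q hv
  have hRα := hlip R hα
  have hac : AbsolutelyContinuousOnInterval
      (fun τ => modifiedEnergy R c (Q (R (y τ))) (Q (R (v τ)))) s t :=
    ((absolutelyContinuousOnInterval_inner hst hα hα).add
      (absolutelyContinuousOnInterval_inner hst hβ hβ)).add
    (((absolutelyContinuousOnInterval_inner hst hRα hβ).const_mul c).add
      ((absolutelyContinuousOnInterval_inner hst hRα hRα).const_mul (c ^ 2 / 2)))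
  simp only [← hQ]
  rw [← hac.integral_deriv_eq_sub]
  refine intervalIntegral.integral_congr_ae ?_
  have hne : ∀ᵐ τ : ℝ, τ ≠ t := by simp [ae_iff, measure_singleton]
  filter_upwards [h.ae_hasDerivAt hA hAa hs hst, hne] with τ hτ hτt hmem
  rw [uIoc_of_le hst] at hmem
  have hτ' := hτ ⟨hmem.1, lt_of_le_of_ne hmem.2 hτt⟩
  have hτ0 : 0 < τ := hs.trans_lt hmem.1
  have dα : HasDerivAt (fun τ => Q (R (y τ))) (Q (v τ)) τ :=
    Q.hasFDerivAt.comp_hasDerivAt τ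
      ((h.hasDerivWithinAt τ hτ0.le).hasDerivAt (Ici_mem_nhds hτ0))
  have dβ : HasDerivAt (fun τ => Q (R (v τ)))
      (-(Q (y τ) + Q (R (A τ (R (y τ)))) + c • Q (R (v τ)))) τ := by
    have : HasDerivAt (fun τ => Q (R (v τ))) (Q (smoothedForce R A c y v τ)) τ :=
      Q.hasFDerivAt.comp_hasDerivAt τ hτ'
    simpa only [smoothedForce, map_neg, map_add, map_smul] using this
  have dRα : HasDerivAt (fun τ => R (Q (R (y τ)))) (Q (R (v τ))) τ := by
    rw [hQ]
    exact R.hasFDerivAt.comp_hasDerivAt τ dα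
  have hd : HasDerivAt (fun τ => modifiedEnergy R c (Q (R (y τ))) (Q (R (v τ)))) _ τ :=
    ((dα.inner ℝ dα).add (dβ.inner ℝ dβ)).add
    (((dRα.inner ℝ dβ).const_mul c).add ((dRα.inner ℝ dRα).const_mul (c ^ 2 / 2)))
  have hval := deriv_modifiedEnergy_eq hsymm c (Q (v τ)) (Q (y τ)) (Q (R (A τ (R (y τ)))))
  rw [← hQ (v τ), ← hQ (y τ)] at hval
  rw [hval] at hd
  exact hd.deriv

/-- The energy identity for solutions without any extra regularity, obtained by removing the
smoothing. -/
theorem IsReducedSolution.energy_identity (h : IsReducedSolution R A c y v) (hc : 0 < c)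
    (hA : AEStronglyMeasurable A (volume.restrict (Ici 0)))
    (hAa : ∀ᵐ τ ∂(volume.restrict (Ici (0 : ℝ))), ‖A τ‖ ≤ a)
    (hsymm : ∀ x y, inner ℝ (R x) y = inner ℝ x (R y)) (hinj : ∀ x, R x = 0 → x = 0)
    (hpos : ∀ x, 0 ≤ inner ℝ (R x) x) {s t : ℝ} (hs : 0 ≤ s) (hst : s ≤ t) :
    modifiedEnergy R c (y t) (v t) - modifiedEnergy R c (y s) (v s)
      = ∫ τ in s..t, energyRate R c (y τ) (v τ) (A τ (R (y τ))) := by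
  obtain ⟨Q, hQcomm, hQn, hQlim⟩ := exists_approx_inverse hsymm hinj hpos
  obtain ⟨N, hy, hv, hz⟩ := h.exists_bound hAa (t := t) hs
  have hE : ∀ τ, Tendsto (fun n => modifiedEnergy R c (R (Q n (y τ))) (R (Q n (v τ)))) atTop
      (𝓝 (modifiedEnergy R c (y τ) (v τ))) := fun τ =>
    ((continuous_modifiedEnergy R c).tendsto (y τ, v τ)).comp
      ((hQlim (y τ)).prodMk_nhds (hQlim (v τ)))
  have hlim : Tendsto (fun n => ∫ τ in s..t,
      energyRate R c (R (Q n (y τ))) (R (Q n (v τ))) (R (Q n (A τ (R (y τ)))))) atTop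
      (𝓝 (∫ τ in s..t, energyRate R c (y τ) (v τ) (A τ (R (y τ))))) := by
    refine intervalIntegral.tendsto_integral_filter_of_dominated_convergence
      (fun _ => c * N ^ 2 + c * N ^ 2 + 2 * (N * (N + c / 2 * (‖R‖ * N))))
      (Eventually.of_forall fun n => ?_) (Eventually.of_forall fun n => ?_) (by simp)
      (Eventually.of_forall fun τ _ => ?_)
    · have hJ : Continuous fun x => R (Q n x) := R.continuous.comp (Q n).continuous
      have hle : volume.restrict (uIoc s t) ≤ volume.restrict (Ici (0 : ℝ)) := by
        rw [uIoc_of_le hst]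
        exact Measure.restrict_mono (fun x hx => hs.trans hx.1.le) le_rfl
      refine ((continuous_energyRate R c).comp_aestronglyMeasurable
        ((hJ.comp_aestronglyMeasurable
          (h.continuousOn.aestronglyMeasurable measurableSet_Ici)).prodMk
        ((hJ.comp_aestronglyMeasurable
          (h.continuousOn_deriv.aestronglyMeasurable measurableSet_Ici)).prodMk
        (hJ.comp_aestronglyMeasurable
          (h.aestronglyMeasurable_perturbation hA))))).mono_measure hle
    · filter_upwards [hz] with τ hτ hmem
      rw [uIoc_of_le hst] at hmem
      have hmem' := Ioc_subset_Icc_self hmem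
      exact abs_energyRate_le R hc ((hQn n _).trans (hy τ hmem')) ((hQn n _).trans (hv τ hmem'))
        ((hQn n _).trans (hτ hmem'))
    · have hp := (hQlim (y τ)).prodMk_nhds
        ((hQlim (v τ)).prodMk_nhds (hQlim (A τ (R (y τ)))))
      exact ((continuous_energyRate R c).tendsto _).comp hp
  refine tendsto_nhds_unique ((hE t).sub (hE s)) (hlim.congr fun n => ?_)
  exact (h.smoothed_energy_identity hA hAa hsymm (hQcomm n) hs hst).symm

end EnergyIdentity

/-! ### Exponential decay -/

section Decay

variable {H : Type*} [NormedAddCommGroup H] [InnerProductSpace ℝ H]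
  {R : H →L[ℝ] H} {A : ℝ → H →L[ℝ] H} {a b c : ℝ} {y v : ℝ → H}

theorem le_two_mul_modifiedEnergy (hc : 0 < c) (α β : H) :
    ‖α‖ ^ 2 + ‖β‖ ^ 2 ≤ 2 * modifiedEnergy R c α β := by
  simp only [modifiedEnergy, real_inner_self_eq_norm_sq]
  have h1 := (abs_le.1 (abs_real_inner_le_norm (R α) β)).1
  have h2 := mul_le_mul_of_nonneg_left h1 hc.le
  nlinarith [sq_nonneg (‖β‖ - c * ‖R α‖), sq_nonneg ‖α‖]

theorem modifiedEnergy_le (hc : 0 < c) (hb : 0 < b) (hR : ∀ x, b * ‖R x‖ ^ 2 ≤ ‖x‖ ^ 2)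
    (α β : H) : modifiedEnergy R c α β ≤ (2 + c ^ 2 / b) * (‖α‖ ^ 2 + ‖β‖ ^ 2) := by
  simp only [modifiedEnergy, real_inner_self_eq_norm_sq]
  have h1 := (abs_le.1 (abs_real_inner_le_norm (R α) β)).2
  have h2 := mul_le_mul_of_nonneg_left h1 hc.le
  have h3 : c ^ 2 * ‖R α‖ ^ 2 ≤ c ^ 2 / b * ‖α‖ ^ 2 := by
    rw [div_mul_eq_mul_div, le_div_iff₀ hb]
    nlinarith [hR α, sq_nonneg c]
  have h4 : 0 ≤ c ^ 2 / b * ‖β‖ ^ 2 := by positivity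
  nlinarith [sq_nonneg (‖β‖ - c * ‖R α‖), sq_nonneg ‖α‖, sq_nonneg ‖β‖]

/-- The dissipation absorbs the perturbation: the quadratic form
`k |β|² - 2 a |R α| |β| + (k b - a c) |R α|²` is nonnegative when `a² ≤ k (k b - a c)`. -/
theorem energyRate_le {k : ℝ} (hk : 0 < k) (hc : 0 < c)
    (hka : a ^ 2 ≤ k * (k * b - a * c)) (hR : ∀ x, b * ‖R x‖ ^ 2 ≤ ‖x‖ ^ 2) {α β z : H}
    (hz : ‖z‖ ≤ a * ‖R α‖) :
    energyRate R c α β z ≤ -(c - k) * (‖α‖ ^ 2 + ‖β‖ ^ 2) := by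
  simp only [energyRate, real_inner_self_eq_norm_sq]
  have h1 : ‖β + (c / 2) • R α‖ ≤ ‖β‖ + c / 2 * ‖R α‖ := by
    refine (norm_add_le _ _).trans_eq ?_
    rw [norm_smul, Real.norm_of_nonneg (by positivity)]
  have h2 : -inner ℝ z (β + (c / 2) • R α) ≤ a * ‖R α‖ * (‖β‖ + c / 2 * ‖R α‖) :=
    (neg_le_abs _).trans ((abs_real_inner_le_norm _ _).trans
      (mul_le_mul hz h1 (norm_nonneg _) ((norm_nonneg _).trans hz)))
  have h3 : 0 ≤ k * ‖β‖ ^ 2 - 2 * a * ‖R α‖ * ‖β‖ + (k * b - a * c) * ‖R α‖ ^ 2 := by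
    refine nonneg_of_mul_nonneg_right (a := k) ?_ hk
    have h4 := mul_le_mul_of_nonneg_right hka (sq_nonneg ‖R α‖)
    have h5 := sq_nonneg (k * ‖β‖ - a * ‖R α‖)
    nlinarith
  have h6 := mul_le_mul_of_nonneg_left (hR α) hk.le
  nlinarith

/-- The differential inequality `Φ' ≤ -δ Φ` for the modified energy, in integrated form. -/
theorem IsReducedSolution.modifiedEnergy_sub_le [CompleteSpace H]
    (h : IsReducedSolution R A c y v) (hc : 0 < c) (hb : 0 < b)
    (hA : AEStronglyMeasurable A (volume.restrict (Ici 0)))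
    (hAa : ∀ᵐ τ ∂(volume.restrict (Ici (0 : ℝ))), ‖A τ‖ ≤ a)
    (hsymm : ∀ x y, inner ℝ (R x) y = inner ℝ x (R y)) (hinj : ∀ x, R x = 0 → x = 0)
    (hpos : ∀ x, 0 ≤ inner ℝ (R x) x) (hR : ∀ x, b * ‖R x‖ ^ 2 ≤ ‖x‖ ^ 2) {k : ℝ} (hk : 0 < k)
    (hkc : k ≤ c) (hka : a ^ 2 ≤ k * (k * b - a * c)) {s t : ℝ} (hs : 0 ≤ s) (hst : s ≤ t) :
    modifiedEnergy R c (y t) (v t) - modifiedEnergy R c (y s) (v s)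
      ≤ ∫ τ in s..t, -((c - k) / (2 + c ^ 2 / b)) * modifiedEnergy R c (y τ) (v τ) := by
  have hsub : Icc s t ⊆ Ici 0 := fun x hx => hs.trans hx.1
  rw [h.energy_identity hc hA hAa hsymm hinj hpos hs hst]
  obtain ⟨N, hy, hv, hz⟩ := h.exists_bound hAa (t := t) hs
  refine intervalIntegral.integral_mono_ae_restrict hst ?_ ?_ ?_
  · refine intervalIntegrable_of_ae_bound
      (C := c * N ^ 2 + c * N ^ 2 + 2 * (N * (N + c / 2 * (‖R‖ * N)))) hs hst
      ((continuous_energyRate R c).comp_aestronglyMeasurable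
        ((h.continuousOn.aestronglyMeasurable measurableSet_Ici).prodMk
        ((h.continuousOn_deriv.aestronglyMeasurable measurableSet_Ici).prodMk
        (h.aestronglyMeasurable_perturbation hA)))) ?_
    filter_upwards [hz] with τ hτ hmem
    exact abs_energyRate_le R hc (hy τ hmem) (hv τ hmem) (hτ hmem)
  · refine ContinuousOn.intervalIntegrable_of_Icc hst (continuousOn_const.mul ?_)
    exact (continuous_modifiedEnergy R c).comp_continuousOn
      ((h.continuousOn.mono hsub).prodMk (h.continuousOn_deriv.mono hsub))
  · refine (ae_restrict_iff' measurableSet_Icc).2 ?_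
    filter_upwards [ae_of_ae_restrict_Ici hAa] with τ hτ hmem
    have h1 : ‖A τ (R (y τ))‖ ≤ a * ‖R (y τ)‖ := ((A τ).le_opNorm _).trans
      (mul_le_mul_of_nonneg_right (hτ (hsub hmem)) (norm_nonneg _))
    refine (energyRate_le hk hc hka hR h1).trans ?_
    rw [neg_mul, neg_mul, neg_le_neg_iff, div_mul_eq_mul_div, div_le_iff₀ (by positivity),
      mul_assoc]
    refine mul_le_mul_of_nonneg_left ?_ (sub_nonneg.2 hkc)
    rw [mul_comm (‖y τ‖ ^ 2 + ‖v τ‖ ^ 2)]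
    exact modifiedEnergy_le hc hb hR _ _

/-- Energy solutions in terms of `R = B^{-1/2}`: the test element `p` of `V` is written `R w`, and
the `V`-norm of `p` is `|w|`. -/
theorem IsEnergySolution.isReducedSolution [CompleteSpace H] {B : H →ₗ.[ℝ] H}
    {u : ℝ → EnergySpace B} {u' : ℝ → H}
    (h : IsEnergySolution B A (c • ContinuousLinearMap.id ℝ H) u u')
    (hsymm : ∀ x y, inner ℝ (R x) y = inner ℝ x (R y))
    (hgraph : ∀ x z, (x, z) ∈ (sqrtOp B).graph ↔ x = R z) :
    IsReducedSolution R A c (fun t => sqrtOp B (u t)) u' := by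
  have hRS : ∀ x : EnergySpace B, R (sqrtOp B x) = x := fun x =>
    ((hgraph _ _).1 ((sqrtOp B).mem_graph x)).symm
  have hpre : ∀ w, ∃ x : EnergySpace B, (x : H) = R w ∧ sqrtOp B x = w := fun w =>
    (LinearPMap.mem_graph_iff _).1 ((hgraph (R w) w).2 rfl)
  refine ⟨h.continuousOn, fun t ht => ?_, h.continuousOn_deriv, fun T => ?_, fun w => ?_⟩
  · simp only [hRS]
    exact h.hasDerivWithinAt t ht
  · obtain ⟨K, hK⟩ := h.lipschitz_dual T
    refine ⟨|K|, fun s hs t ht => ?_⟩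
    -- test with the element of `V` whose image under `B^{1/2}` is `x = R (u' t - u' s)`
    set x := R (u' t) - R (u' s) with hx
    obtain ⟨p, hp1, hp2⟩ := hpre x
    have h1 := hK s hs t ht p
    rw [hp1, ← hsymm, map_sub, ← hx, real_inner_self_eq_norm_sq, abs_of_nonneg (by positivity),
      energyNorm, hp2] at h1
    rcases eq_or_lt_of_le (norm_nonneg x) with h0 | h0
    · rw [← h0]; positivity
    · have h2 : ‖x‖ ≤ K * |t - s| := by
        rw [pow_two] at h1
        exact le_of_mul_le_mul_right h1 h0
      exact h2.trans (mul_le_mul_of_nonneg_right (le_abs_self K) (abs_nonneg _))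
  · obtain ⟨p, hp1, hp2⟩ := hpre w
    filter_upwards [h.equation p] with t ht
    have h1 : (fun τ => inner ℝ w (R (u' τ))) = fun τ => inner ℝ (u' τ) (p : H) := by
      ext τ
      rw [hp1, ← hsymm, real_inner_comm]
    rw [h1]
    convert ht using 1
    rw [smoothedForce, hRS, energyForm, hp2, hp1, inner_neg_right, inner_add_right,
      inner_add_right, real_inner_smul_right, ← hsymm w, ← hsymm w, real_inner_comm w,
      real_inner_comm (R w), real_inner_comm (R w), _root_.smul_apply,
      ContinuousLinearMap.id_apply, real_inner_smul_right]

end Decay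

end DissipativeEvolution

open DissipativeEvolution MeasureTheory in
theorem corollary4p2 {H : Type*} [NormedAddCommGroup H] [InnerProductSpace ℝ H] [CompleteSpace H]
    (B : H →ₗ.[ℝ] H) (hB : IsSelfAdjoint B)
    (b : ℝ) (hb : 0 < b) (hBb : CoerciveWith B b)
    (A : ℝ → H →L[ℝ] H) (hA : MemLp A ⊤ (volume.restrict (Set.Ici (0 : ℝ))))
    (c : ℝ) (hc : 0 < c)
    (hAc : (eLpNorm A ⊤ (volume.restrict (Set.Ici (0 : ℝ)))).toReal
      < c * √(b + c ^ 2 / 4) - c ^ 2 / 2) :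
    ∃ δ > 0, ∃ M > 0, ∀ (u : ℝ → EnergySpace B) (u' : ℝ → H),
      IsEnergySolution B A (c • ContinuousLinearMap.id ℝ H) u u' →
      ∀ s t : ℝ, 0 ≤ s → s ≤ t →
        energyNorm B (u t) ^ 2 + ‖u' t‖ ^ 2
          ≤ M * (energyNorm B (u s) ^ 2 + ‖u' s‖ ^ 2) * Real.exp (-δ * (t - s)) := by
  obtain ⟨R, hsymm, hinj, hpos, hR, hgraph⟩ := exists_inverse_sqrtOp hB hb hBb
  set a := (eLpNorm A ⊤ (volume.restrict (Set.Ici (0 : ℝ)))).toReal with ha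
  have ha0 : 0 ≤ a := ENNReal.toReal_nonneg
  have hAa : ∀ᵐ τ ∂(volume.restrict (Set.Ici (0 : ℝ))), ‖A τ‖ ≤ a := by
    filter_upwards [ae_le_eLpNormEssSup (f := A) (μ := volume.restrict (Set.Ici (0 : ℝ)))]
      with τ hτ
    rw [← eLpNorm_exponent_top] at hτ
    have := ENNReal.toReal_mono hA.2.ne hτ
    rwa [toReal_enorm] at this
  have hdisc := sq_lt_of_lt_sqrt ha0 hc hb hAc
  -- `η` is the rate left over: `k = c - η` still satisfies `a² ≤ k (k b - a c)`
  set η := (c ^ 2 * (b - a) - a ^ 2) / (2 * c * b) with hη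
  have hη0 : 0 < η := div_pos (by linarith) (by positivity)
  have hηe : 2 * c * b * η = c ^ 2 * (b - a) - a ^ 2 := by rw [hη]; field_simp
  have hηc : η < c := by
    refine lt_of_mul_lt_mul_left (a := 2 * c * b) ?_ (by positivity)
    rw [hηe]
    have h1 : 0 < c ^ 2 * b := by positivity
    have h2 : 0 ≤ c ^ 2 * a := by positivity
    nlinarith [sq_nonneg a]
  have hka : a ^ 2 ≤ (c - η) * ((c - η) * b - a * c) := by
    have h1 : 0 ≤ η ^ 2 * b := by positivity
    have h2 : 0 ≤ a * c * η := by positivity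
    nlinarith
  refine ⟨(c - (c - η)) / (2 + c ^ 2 / b), div_pos (by linarith) (by positivity),
    2 * (2 + c ^ 2 / b), by positivity, fun u u' hu s t hs hst => ?_⟩
  have h := hu.isReducedSolution hsymm hgraph
  have hdecay := le_mul_exp_of_sub_le_integral
    ((continuous_modifiedEnergy R c).comp_continuousOn (h.continuousOn.prodMk h.continuousOn_deriv))
    (fun s t hs hst => h.modifiedEnergy_sub_le hc hb hA.1 hAa hsymm hinj hpos hR
      (sub_pos.2 hηc) (by linarith) hka hs hst) hs hst
  have hlow := le_two_mul_modifiedEnergy (R := R) hc (sqrtOp B (u t)) (u' t)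
  have hup := modifiedEnergy_le hc hb hR (sqrtOp B (u s)) (u' s)
  refine hlow.trans ((mul_le_mul_of_nonneg_left (hdecay.trans
    (mul_le_mul_of_nonneg_right hup (Real.exp_pos _).le)) zero_le_two).trans_eq ?_)
  unfold energyNorm
  ring
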